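/- Let $n\ge 1$, and for $x\in\mathbb{R}^n$, $A\in \mathrm{O}_n$ let $[x,A]$ denote the isometry $z\mapsto A(z+x)$ of $\mathbb{R}^n$. Let $\Gamma$ be a crystal group in dimension $n$, i.e. a discrete subgroup of the group of isometries of $\mathbb{R}^n$ (topologized as $\mathbb{R}^n\times \mathrm{O}_n$) such that the orbit space $\mathbb{R}^n/\Gamma$ is compact. Let $\Pi=\{A:[x,A]\in\Gamma\text{ for some }x\}$ be its point group, $\mathcal{L}=\{\ell\in\mathbb{R}^n:[\ell,\mathrm{id}]\in\Gamma\}$ its translation lattice and $\mathcal{L}^*=\{\nu\in\mathbb{R}^n:\nu\cdot\ell\in\mathbb{Z}\text{ for all }\ell\in\mathcal{L}\}$ the dual lattice. Let $\Gamma^*=\mathcal{L}^*\rtimes\Pi$ act on $\mathbb{R}^n$ by $(\nu,M)\cdot\omega=M(\omega+\nu)$, let $\omega_0\in\mathbb{R}^n$ be a point with trivial stabilizer in $\Gamma^*$, and let $$\Omega=\{\omega\in\mathbb{R}^n:\|\omega-\omega_0\|<\|\omega-M(\omega_0+\nu)\|\text{ for all }(\nu,M)\in\Gamma^*\setminus\{(0,\mathrm{id})\}\}$$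 be the Dirichlet domain of $\Gamma^*$ containing $\omega_0$. Equip $\Pi\Omega=\bigcup_{M\in\Pi}M\Omega$ with the restriction of Lebesgue measure, and let $\widehat\pi_3$ be the unitary representation of $\Gamma$ on $L^2(\Pi\Omega,\ell^2(\mathcal{L}^*))$ given, for $[x,M]\in\Gamma$, by $$\widehat\pi_3[x,M]F(\theta)=e^{2\pi i(M^{-1}\theta)\cdot x}F(M^{-1}\theta)\quad\text{for a.e. }\theta\in\Pi\Omega .$$ A measurable range function for $\ell^2(\mathcal{L}^*)$ based on $\Pi\Omega$ is a map $J$ from $\Pi\Omega$ to the set of closed subspaces of $\ell^2(\mathcal{L}^*)$ such that $\theta\mapsto\langle P_{J(\theta)}\xi,\eta\rangle$ is measurable for all $\xi,\eta\in\ell^2(\mathcal{L}^*)$, where $P_{J(\theta)}$ is the orthogonal projection onto $J(\theta)$. It is called $\Pi$-invariant if $J(L\theta)=J(\theta)$ for a.e. $\theta\in\Pi\Omega$ and every $L\in\Pi$. Put $\mathcal{M}_J=\{F\in L^2(\Pi\Omega,\ell^2(\mathcal{L}^*)):F(\theta)\in J(\theta)\text{ for a.e. }\theta\in\Pi\Omega\}$.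 Let $\mathcal{K}$ be a closed subspace of $L^2(\Pi\Omega,\ell^2(\mathcal{L}^*))$. Then $\mathcal{K}$ is $\widehat\pi_3$-invariant (that is, $\widehat\pi_3[x,M]\mathcal{K}\subseteq\mathcal{K}$ for all $[x,M]\in\Gamma$) if and only if there exists a $\Pi$-invariant measurable range function $J$ for $\ell^2(\mathcal{L}^*)$ based on $\Pi\Omega$ such that $\mathcal{K}=\mathcal{M}_J$. -/

import Mathlib

open MeasureTheory

noncomputable section

namespace CrystalGroup

/-- Euclidean space `ℝⁿ`. -/
abbrev E (n : ℕ) : Type := EuclideanSpace ℝ (Fin n)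

/-- The group `Iso_n(ℝ)` of isometries of `ℝⁿ`, under composition. -/
abbrev EucIso (n : ℕ) : Type := E n ≃ᵃⁱ[ℝ] E n

/-- The homomorphism `q : Iso_n(ℝ) → O_n`, `[x, A] ↦ A`, where `O_n` is the group of
linear isometries of `ℝⁿ`. -/
def linPart {n : ℕ} : EucIso n →* (E n ≃ₗᵢ[ℝ] E n) where
  toFun g := g.linearIsometryEquiv
  map_one' := rfl
  map_mul' _ _ := rfl

/-- The vector `x` of the isometry `[x, A] : z ↦ A (z + x)`. -/
def transPart {n : ℕ} (g : EucIso n) : E n := (linPart g)⁻¹ (g 0)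

theorem eucIso_apply {n : ℕ} (g : EucIso n) (z : E n) : g z = linPart g (z + transPart g) := by
  have h1 : linPart g (transPart g) = g 0 := (linPart g).apply_symm_apply (g 0)
  have h2 := g.map_vadd 0 z
  rw [vadd_eq_add, add_zero, vadd_eq_add] at h2
  rw [map_add, h1, h2]
  rfl

theorem transPart_one {n : ℕ} : transPart (1 : EucIso n) = 0 := rfl

/-- `[x, A] [y, B] = [B⁻¹ x + y, A B]`. -/
theorem transPart_mul {n : ℕ} (g h : EucIso n) :
    transPart (g * h) = (linPart h)⁻¹ (transPart g) + transPart h := by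
  have h1 : (g * h) 0 = g (h 0) := rfl
  have h2 : linPart h (transPart h) = h 0 := (linPart h).apply_symm_apply (h 0)
  have h3 : ∀ v, (linPart (g * h))⁻¹ v = (linPart h)⁻¹ ((linPart g)⁻¹ v) := by
    intro v
    rw [map_mul, mul_inv_rev]
    rfl
  have h4 : ∀ (A : E n ≃ₗᵢ[ℝ] E n) (v : E n), A⁻¹ (A v) = v := fun A v => A.symm_apply_apply v
  rw [transPart, h3, h1, eucIso_apply g (h 0), h4, map_add, ← h2, h4, add_comm]

/-- The topology of `Iso_n(ℝ)`: the product topology of `ℝⁿ × O_n` in the coordinates `[x, A]`,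
with `O_n` a subspace of the space of linear operators on `ℝⁿ`. -/
@[reducible] def isoTopology (n : ℕ) : TopologicalSpace (EucIso n) :=
  TopologicalSpace.induced
    (fun g => (transPart g, ((linPart g).toContinuousLinearEquiv : E n →L[ℝ] E n)))
    inferInstance

/-- Two points are equivalent when they lie in the same `Γ`-orbit. -/
def orbitSetoid {n : ℕ} (Γ : Subgroup (EucIso n)) : Setoid (E n) where
  r z w := ∃ g ∈ Γ, g z = w
  iseqv :=
    { refl := fun _ => ⟨1, Γ.one_mem, rfl⟩
      symm := by
        rintro z w ⟨g, hg, rfl⟩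
        exact ⟨g⁻¹, Γ.inv_mem hg, g.symm_apply_apply z⟩
      trans := by
        rintro z w u ⟨g, hg, rfl⟩ ⟨h, hh, rfl⟩
        exact ⟨h * g, Γ.mul_mem hh hg, rfl⟩ }

/-- A crystal group: a discrete subgroup `Γ` of `Iso_n(ℝ)` whose space of orbits `ℝⁿ / Γ`,
with the quotient topology, is compact. -/
structure IsCrystalGroup {n : ℕ} (Γ : Subgroup (EucIso n)) : Prop where
  discrete : @DiscreteTopology Γ (@instTopologicalSpaceSubtype _ (· ∈ Γ) (isoTopology n))
  cocompact : CompactSpace (Quotient (orbitSetoid Γ))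

/-- The point group `Π = q(Γ)`. -/
def pointGroup {n : ℕ} (Γ : Subgroup (EucIso n)) : Subgroup (E n ≃ₗᵢ[ℝ] E n) := Γ.map linPart

/-- The vectors `ℓ` such that the translation `[ℓ, id]` belongs to `Γ`. -/
def translationLattice {n : ℕ} (Γ : Subgroup (EucIso n)) : AddSubgroup (E n) where
  carrier := {ℓ | AffineIsometryEquiv.constVAdd ℝ (E n) ℓ ∈ Γ}
  zero_mem' := by
    have h : AffineIsometryEquiv.constVAdd ℝ (E n) (0 : E n) = (1 : EucIso n) := by
      ext1 z
      exact zero_vadd (E n) z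
    simpa only [Set.mem_ofPred_eq, h] using Γ.one_mem
  add_mem' := by
    intro a b ha hb
    have h : AffineIsometryEquiv.constVAdd ℝ (E n) (a + b) =
        (AffineIsometryEquiv.constVAdd ℝ (E n) a * AffineIsometryEquiv.constVAdd ℝ (E n) b :
          EucIso n) := by
      ext1 z
      exact add_vadd a b z
    simpa only [Set.mem_ofPred_eq, h] using Γ.mul_mem ha hb
  neg_mem' := by
    intro a ha
    have h : AffineIsometryEquiv.constVAdd ℝ (E n) (-a) =
        (AffineIsometryEquiv.constVAdd ℝ (E n) a : EucIso n)⁻¹ := by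
      ext1 z
      rfl
    simpa only [Set.mem_ofPred_eq, h] using Γ.inv_mem ha

/-- The dual `{ν | ν · ℓ ∈ ℤ for all ℓ ∈ 𝓛}` of a subgroup `𝓛` of `ℝⁿ`. -/
def dual {n : ℕ} (𝓛 : AddSubgroup (E n)) : AddSubgroup (E n) where
  carrier := {ν | ∀ ℓ ∈ 𝓛, ∃ m : ℤ, inner ℝ ν ℓ = (m : ℝ)}
  zero_mem' := fun ℓ _ => ⟨0, by simp⟩
  add_mem' := by
    intro a b ha hb ℓ hℓ
    obtain ⟨p, hp⟩ := ha ℓ hℓ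
    obtain ⟨r, hr⟩ := hb ℓ hℓ
    exact ⟨p + r, by rw [inner_add_left, hp, hr, Int.cast_add]⟩
  neg_mem' := by
    intro a ha ℓ hℓ
    obtain ⟨p, hp⟩ := ha ℓ hℓ
    exact ⟨-p, by rw [inner_neg_left, hp, Int.cast_neg]⟩

/-- The dual lattice `𝓛*` of the translation lattice `𝓛` of `Γ`. -/
def dualLattice {n : ℕ} (Γ : Subgroup (EucIso n)) : AddSubgroup (E n) :=
  dual (translationLattice Γ)

/-- The stabilizer of `ω₀` in `Γ* = 𝓛* ⋊ Π` is trivial, where `(ν, M) ∈ Γ*` acts on `ℝⁿ` as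
`ω ↦ M (ω + ν)`. -/
def TrivialStabilizer {n : ℕ} (Γ : Subgroup (EucIso n)) (ω₀ : E n) : Prop :=
  ∀ ν ∈ dualLattice Γ, ∀ M ∈ pointGroup Γ, M (ω₀ + ν) = ω₀ → ν = 0 ∧ M = 1

/-- The Dirichlet domain `Ω` of `Γ* = 𝓛* ⋊ Π` containing `ω₀`. -/
def dirichletDomain {n : ℕ} (Γ : Subgroup (EucIso n)) (ω₀ : E n) : Set (E n) :=
  {ω | ∀ ν ∈ dualLattice Γ, ∀ M ∈ pointGroup Γ, ¬ (ν = 0 ∧ M = 1) →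
    ‖ω - ω₀‖ < ‖ω - M (ω₀ + ν)‖}

/-- The set `ΠΩ`, the union of the sets `M Ω` with `M ∈ Π`. -/
def pointOrbit {n : ℕ} (Γ : Subgroup (EucIso n)) (ω₀ : E n) : Set (E n) :=
  ⋃ M ∈ pointGroup Γ, (fun ω => M ω) '' dirichletDomain Γ ω₀

/-- `ΠΩ` is equipped with the restriction of Lebesgue measure. -/
def orbitMeasure {n : ℕ} (Γ : Subgroup (EucIso n)) (ω₀ : E n) : Measure (pointOrbit Γ ω₀) :=
  Measure.comap Subtype.val volume

theorem map_mem_pointOrbit {n : ℕ} {Γ : Subgroup (EucIso n)} {ω₀ : E n}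
    {M : E n ≃ₗᵢ[ℝ] E n} (hM : M ∈ pointGroup Γ) {θ : E n} (hθ : θ ∈ pointOrbit Γ ω₀) :
    M θ ∈ pointOrbit Γ ω₀ := by
  simp only [pointOrbit, Set.mem_iUnion, Set.mem_image, exists_prop] at hθ ⊢
  obtain ⟨N, hN, ω, hω, rfl⟩ := hθ
  exact ⟨M * N, (pointGroup Γ).mul_mem hM hN, ω, hω, rfl⟩

/-- The action of the point group `Π` on `ΠΩ`. -/
instance {n : ℕ} (Γ : Subgroup (EucIso n)) (ω₀ : E n) :
    MulAction (pointGroup Γ) (pointOrbit Γ ω₀) where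
  smul M θ := ⟨(M : E n ≃ₗᵢ[ℝ] E n) θ, map_mem_pointOrbit M.2 θ.2⟩
  one_smul _ := rfl
  mul_smul _ _ _ := rfl

theorem coe_smul_pointOrbit {n : ℕ} {Γ : Subgroup (EucIso n)} {ω₀ : E n} (M : pointGroup Γ)
    (θ : pointOrbit Γ ω₀) :
    ((M • θ : pointOrbit Γ ω₀) : E n) = (M : E n ≃ₗᵢ[ℝ] E n) (θ : E n) := rfl

/-- `Π` acts on `ΠΩ` preserving measure. -/
theorem measurePreserving_smul_pointOrbit {n : ℕ} {Γ : Subgroup (EucIso n)} {ω₀ : E n}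
    (M : pointGroup Γ) :
    MeasurePreserving (fun θ : pointOrbit Γ ω₀ => M • θ) (orbitMeasure Γ ω₀) (orbitMeasure Γ ω₀) := by
  have hmeas : ∀ N : pointGroup Γ, Measurable (fun θ : pointOrbit Γ ω₀ => N • θ) := fun N =>
    (((N : E n ≃ₗᵢ[ℝ] E n).continuous.measurable).comp measurable_subtype_coe).subtype_mk
  refine ⟨hmeas M, ?_⟩
  ext s hs
  rw [Measure.map_apply (hmeas M) hs]
  change Measure.comap Subtype.val volume _ = Measure.comap Subtype.val volume _
  by_cases h : Function.Injective (Subtype.val : pointOrbit Γ ω₀ → E n) ∧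
      ∀ s : Set (pointOrbit Γ ω₀), MeasurableSet s → NullMeasurableSet (Subtype.val '' s) volume
  · rw [Measure.comap_apply₀ _ _ h.1 h.2 (hmeas M hs).nullMeasurableSet,
      Measure.comap_apply₀ _ _ h.1 h.2 hs.nullMeasurableSet]
    have himg : (Subtype.val '' ((fun θ : pointOrbit Γ ω₀ => M • θ) ⁻¹' s) : Set (E n)) =
        (fun v => (M : E n ≃ₗᵢ[ℝ] E n) v) ⁻¹' (Subtype.val '' s) := by
      ext v
      constructor
      · rintro ⟨θ, hθ, rfl⟩
        exact ⟨M • θ, hθ, rfl⟩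
      · rintro ⟨θ, hθ, hv⟩
        refine ⟨M⁻¹ • θ, ?_, ?_⟩
        · simpa using hθ
        · rw [coe_smul_pointOrbit, hv]
          exact (M : E n ≃ₗᵢ[ℝ] E n).symm_apply_apply v
    rw [himg]
    exact (M : E n ≃ₗᵢ[ℝ] E n).measurePreserving.measure_preimage_emb
      (M : E n ≃ₗᵢ[ℝ] E n).toHomeomorph.measurableEmbedding _
  · simp [Measure.comap, dif_neg h]

/-- The Hilbert space `ℓ²(𝓛*)`. -/
abbrev EllTwo {n : ℕ} (Γ : Subgroup (EucIso n)) : Type := lp (fun _ : dualLattice Γ => ℂ) 2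

/-- The Hilbert space `L²(ΠΩ, ℓ²(𝓛*))`. -/
abbrev LTwo {n : ℕ} (Γ : Subgroup (EucIso n)) (ω₀ : E n) : Type :=
  Lp (EllTwo Γ) 2 (orbitMeasure Γ ω₀)

/-- The element `M = q(g)` of the point group, for `g = [x, M] ∈ Γ`. -/
def toPointGroup {n : ℕ} (Γ : Subgroup (EucIso n)) : Γ →* pointGroup Γ where
  toFun g := ⟨linPart (g : EucIso n), Subgroup.mem_map_of_mem _ g.2⟩
  map_one' := rfl
  map_mul' _ _ := rfl

/-- `e^{2πi (M⁻¹θ)·x}`, for `g = [x, M]`. -/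
def phase {n : ℕ} {Γ : Subgroup (EucIso n)} {ω₀ : E n} (g : Γ) (θ : pointOrbit Γ ω₀) : ℂ :=
  Complex.exp (2 * Real.pi * Complex.I *
    (inner ℝ (((toPointGroup Γ g)⁻¹ • θ : pointOrbit Γ ω₀) : E n) (transPart (g : EucIso n)) : ℝ))

theorem norm_phase {n : ℕ} {Γ : Subgroup (EucIso n)} {ω₀ : E n} (g : Γ) (θ : pointOrbit Γ ω₀) :
    ‖phase g θ‖ = 1 := by
  rw [phase, ← Complex.norm_exp_ofReal_mul_I (2 * Real.pi *
    inner ℝ (((toPointGroup Γ g)⁻¹ • θ : pointOrbit Γ ω₀) : E n) (transPart (g : EucIso n)))]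
  congr 2
  push_cast
  ring

theorem measurable_phase {n : ℕ} {Γ : Subgroup (EucIso n)} {ω₀ : E n} (g : Γ) :
    Measurable (phase g : pointOrbit Γ ω₀ → ℂ) := by
  have h := (measurePreserving_smul_pointOrbit (ω₀ := ω₀) (toPointGroup Γ g)⁻¹).measurable
  have h2 : Measurable fun θ : pointOrbit Γ ω₀ =>
      (inner ℝ (((toPointGroup Γ g)⁻¹ • θ : pointOrbit Γ ω₀) : E n)
        (transPart (g : EucIso n)) : ℝ) :=
    (measurable_subtype_coe.comp h).inner_const
  unfold phase
  fun_prop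

theorem phase_mul {n : ℕ} {Γ : Subgroup (EucIso n)} {ω₀ : E n} (g h : Γ)
    (θ : pointOrbit Γ ω₀) :
    phase (g * h) θ = phase g θ * phase h ((toPointGroup Γ g)⁻¹ • θ) := by
  rw [phase, phase, phase, ← Complex.exp_add, map_mul, mul_inv_rev, mul_smul, Subgroup.coe_mul,
    transPart_mul, inner_add_right]
  have key : (inner ℝ ((((toPointGroup Γ h)⁻¹ • (toPointGroup Γ g)⁻¹ • θ : pointOrbit Γ ω₀)) : E n)
      ((linPart (h : EucIso n))⁻¹ (transPart (g : EucIso n))) : ℝ) =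
      inner ℝ (((toPointGroup Γ g)⁻¹ • θ : pointOrbit Γ ω₀) : E n) (transPart (g : EucIso n)) :=
    LinearIsometryEquiv.inner_map_map (linPart (h : EucIso n))⁻¹ _ _
  rw [key]
  congr 1
  push_cast
  ring

/-- The function `θ ↦ e^{2πi (M⁻¹θ)·x} F(M⁻¹θ)` on `ΠΩ`, for `g = [x, M]`. -/
def piThreeFun {n : ℕ} {Γ : Subgroup (EucIso n)} {ω₀ : E n} (g : Γ)
    (F : pointOrbit Γ ω₀ → EllTwo Γ) (θ : pointOrbit Γ ω₀) : EllTwo Γ :=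
  phase g θ • F ((toPointGroup Γ g)⁻¹ • θ)

theorem memLp_piThreeFun {n : ℕ} {Γ : Subgroup (EucIso n)} {ω₀ : E n} (g : Γ) (F : LTwo Γ ω₀) :
    MemLp (piThreeFun g F) 2 (orbitMeasure Γ ω₀) := by
  have h := (Lp.memLp F).comp_measurePreserving
    (measurePreserving_smul_pointOrbit (ω₀ := ω₀) (toPointGroup Γ g)⁻¹)
  refine h.congr_norm ((measurable_phase g).aestronglyMeasurable.smul h.1) ?_
  filter_upwards with θ
  simp [piThreeFun, norm_smul, norm_phase]

theorem piThreeFun_congr {n : ℕ} {Γ : Subgroup (EucIso n)} {ω₀ : E n} (g : Γ)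
    {F G : pointOrbit Γ ω₀ → EllTwo Γ} (h : F =ᵐ[orbitMeasure Γ ω₀] G) :
    piThreeFun g F =ᵐ[orbitMeasure Γ ω₀] piThreeFun g G := by
  filter_upwards [(measurePreserving_smul_pointOrbit (ω₀ := ω₀)
    (toPointGroup Γ g)⁻¹).quasiMeasurePreserving.ae_eq_comp h] with θ hθ
  simp only [Function.comp_apply] at hθ
  rw [piThreeFun, hθ, piThreeFun]

/-- The isometry `π̂₃(g)` of `L²(ΠΩ, ℓ²(𝓛*))`. -/
def piThreeIsometry {n : ℕ} {Γ : Subgroup (EucIso n)} {ω₀ : E n} (g : Γ) :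
    LTwo Γ ω₀ →ₗᵢ[ℂ] LTwo Γ ω₀ where
  toFun F := (memLp_piThreeFun g F).toLp _
  map_add' F G := by
    rw [← MemLp.toLp_add, MemLp.toLp_eq_toLp_iff]
    refine (piThreeFun_congr g (Lp.coeFn_add F G)).trans ?_
    filter_upwards with θ
    simp [piThreeFun, smul_add]
  map_smul' c F := by
    rw [RingHom.id_apply, ← MemLp.toLp_const_smul, MemLp.toLp_eq_toLp_iff]
    refine (piThreeFun_congr g (Lp.coeFn_smul c F)).trans ?_
    filter_upwards with θ
    simp only [piThreeFun, Pi.smul_apply]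
    rw [smul_comm]
  norm_map' F := by
    change ‖(memLp_piThreeFun g F).toLp _‖ = ‖F‖
    rw [← Lp.norm_compMeasurePreserving F
      (measurePreserving_smul_pointOrbit (ω₀ := ω₀) (toPointGroup Γ g)⁻¹)]
    have key : ∀ᵐ θ ∂(orbitMeasure Γ ω₀), ‖(memLp_piThreeFun g F).toLp _ θ‖ =
        ‖Lp.compMeasurePreserving _
          (measurePreserving_smul_pointOrbit (ω₀ := ω₀) (toPointGroup Γ g)⁻¹) F θ‖ := by
      filter_upwards [MemLp.coeFn_toLp (memLp_piThreeFun g F), Lp.coeFn_compMeasurePreserving F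
        (measurePreserving_smul_pointOrbit (ω₀ := ω₀) (toPointGroup Γ g)⁻¹)] with θ h1 h2
      rw [h1, h2, piThreeFun, norm_smul, norm_phase, one_mul]
      rfl
    exact le_antisymm (Lp.norm_le_norm_of_ae_le (key.mono fun _ h => h.le))
      (Lp.norm_le_norm_of_ae_le (key.mono fun _ h => h.ge))

theorem piThreeIsometry_ae {n : ℕ} {Γ : Subgroup (EucIso n)} {ω₀ : E n} (g : Γ)
    (F : LTwo Γ ω₀) : piThreeIsometry g F =ᵐ[orbitMeasure Γ ω₀] piThreeFun g F :=
  MemLp.coeFn_toLp (memLp_piThreeFun g F)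

theorem piThreeIsometry_one {n : ℕ} {Γ : Subgroup (EucIso n)} {ω₀ : E n} (F : LTwo Γ ω₀) :
    piThreeIsometry (1 : Γ) F = F := by
  refine Lp.ext ((piThreeIsometry_ae 1 F).trans ?_)
  filter_upwards with θ
  simp [piThreeFun, phase, transPart_one]

theorem piThreeIsometry_mul {n : ℕ} {Γ : Subgroup (EucIso n)} {ω₀ : E n} (g h : Γ)
    (F : LTwo Γ ω₀) :
    piThreeIsometry (g * h) F = piThreeIsometry g (piThreeIsometry h F) := by
  refine Lp.ext ((piThreeIsometry_ae (g * h) F).trans ?_)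
  refine Filter.EventuallyEq.trans ?_ (piThreeIsometry_ae g _).symm
  refine Filter.EventuallyEq.trans ?_ (piThreeFun_congr g (piThreeIsometry_ae h F)).symm
  filter_upwards with θ
  simp only [piThreeFun]
  rw [phase_mul, mul_smul, map_mul, mul_inv_rev, mul_smul]

/-- The unitary representation `π̂₃` of `Γ` on `L²(ΠΩ, ℓ²(𝓛*))`:
`π̂₃[x, M] F(θ) = e^{2πi (M⁻¹θ)·x} F(M⁻¹θ)` for almost every `θ ∈ ΠΩ`. -/
def piThree {n : ℕ} (Γ : Subgroup (EucIso n)) (ω₀ : E n) :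
    Γ →* (LTwo Γ ω₀ ≃ₗᵢ[ℂ] LTwo Γ ω₀) where
  toFun g :=
    { toLinearEquiv := LinearEquiv.ofLinearMap (piThreeIsometry g).toLinearMap
        (piThreeIsometry g⁻¹).toLinearMap
        (by
          ext1 F
          change piThreeIsometry g (piThreeIsometry g⁻¹ F) = F
          rw [← piThreeIsometry_mul, mul_inv_cancel, piThreeIsometry_one])
        (by
          ext1 F
          change piThreeIsometry g⁻¹ (piThreeIsometry g F) = F
          rw [← piThreeIsometry_mul, inv_mul_cancel, piThreeIsometry_one])
      norm_map' := (piThreeIsometry g).norm_map }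
  map_one' := by
    ext1 F
    exact piThreeIsometry_one F
  map_mul' g h := by
    ext1 F
    exact piThreeIsometry_mul g h F

theorem piThree_ae {n : ℕ} {Γ : Subgroup (EucIso n)} {ω₀ : E n} (g : Γ) (F : LTwo Γ ω₀) :
    ∀ᵐ θ ∂(orbitMeasure Γ ω₀), piThree Γ ω₀ g F θ =
      Complex.exp (2 * Real.pi * Complex.I *
        (inner ℝ (((toPointGroup Γ g)⁻¹ • θ : pointOrbit Γ ω₀) : E n)
          (transPart (g : EucIso n)) : ℝ)) • F ((toPointGroup Γ g)⁻¹ • θ) :=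
  piThreeIsometry_ae g F

/-- A subspace is invariant under a unitary representation. -/
def IsInvariant {G V : Type*} [Group G] [NormedAddCommGroup V] [InnerProductSpace ℂ V]
    (σ : G →* (V ≃ₗᵢ[ℂ] V)) (K : Submodule ℂ V) : Prop :=
  ∀ g : G, ∀ v ∈ K, σ g v ∈ K

/-- A map `J` from a measurable space to the closed subspaces of a Hilbert space `H` is a
measurable range function if `x ↦ ⟨P_{J(x)} ξ, η⟩` is measurable for all `ξ, η ∈ H`. -/
def IsMeasurableRangeFunction {X H : Type*} [MeasurableSpace X] [NormedAddCommGroup H]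
    [InnerProductSpace ℂ H] [CompleteSpace H] (J : X → ClosedSubmodule ℂ H) : Prop :=
  ∀ ξ η : H, Measurable fun x => inner ℂ ((J x).toSubmodule.starProjection ξ) η

/-- The subspace `𝓜_J = {F ∈ L²(X, H) | F(x) ∈ J(x) for a.e. x}`. -/
def rangeSpace {X H : Type*} [MeasurableSpace X] [NormedAddCommGroup H]
    [InnerProductSpace ℂ H] (μ : Measure X) (J : X → ClosedSubmodule ℂ H) :
    Submodule ℂ (Lp H 2 μ) where
  carrier := {F | ∀ᵐ x ∂μ, F x ∈ J x}
  zero_mem' := by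
    filter_upwards [Lp.coeFn_zero H 2 μ] with x hx
    rw [hx]
    exact (J x).toSubmodule.zero_mem
  add_mem' := by
    intro F G hF hG
    filter_upwards [hF, hG, Lp.coeFn_add F G] with x h1 h2 h3
    rw [h3]
    exact (J x).toSubmodule.add_mem h1 h2
  smul_mem' := by
    intro c F hF
    filter_upwards [hF, Lp.coeFn_smul c F] with x h1 h2
    rw [h2]
    exact (J x).toSubmodule.smul_mem c h1

/-- A range function `J` based on `ΠΩ` is `Π`-invariant if `J(Lθ) = J(θ)` for a.e. `θ ∈ ΠΩ` and
every `L ∈ Π`. -/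
def IsPointInvariant {n : ℕ} {Γ : Subgroup (EucIso n)} {ω₀ : E n}
    (J : pointOrbit Γ ω₀ → ClosedSubmodule ℂ (EllTwo Γ)) : Prop :=
  ∀ᵐ θ ∂(orbitMeasure Γ ω₀), ∀ L : pointGroup Γ, J (L • θ) = J θ

end CrystalGroup

end

/-! A lattice translation acts through `piThree` as multiplication by the character `θ ↦ e^{2πi
θ·ℓ}`. Let `K` be invariant, `F ∈ K` and `G ∈ Kᗮ`. Then the integrable function `⟨G(θ), F(θ)⟩`
integrates to zero against every such character. By the Dirichlet inequalities no two distinct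
points of `ΠΩ` are congruent modulo `𝓛*`, so the characters separate points. A countable group of
unimodular functions that separates points determines finite measures, hence `⟨F(θ), G(θ)⟩ = 0`
almost everywhere (`inner_ae_eq_zero_of_isInvariant`).

Pointwise orthogonality yields the range function: let `J(θ)` be the closed span of the values at
`θ` of a dense sequence in `K`. An element of the section space of `J`, minus its projection to `K`,
lies in `J(θ)` and is orthogonal to `J(θ)` at almost every `θ`, so it vanishes
(`exists_closedSpan_eq_rangeSpace`). Gram–Schmidt makes `J` measurable. The other elements of `Γ`
carry values at `M⁻¹θ` to values at `θ` up to a nonzero phase, so `J(M⁻¹θ) ⊆ J(θ)`; applying this to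
`M` and to its inverse gives equality. The converse is a direct substitution.

The argument uses that `𝓛` spans `ℝⁿ` only through countability of `𝓛*`. If `𝓛` did not span, `ΠΩ`
would be null and the claim trivial, so Bieberbach's theorem is not needed. -/

/-! ### Fourier uniqueness for separating groups of unimodular functions. -/

theorem norm_le_one_of_star_eq_inv {X G : Type*} [Group G] (e : G →* (X → ℂ))
    (hstar : ∀ a, star (e a) = e a⁻¹) (a : G) (x : X) : ‖e a x‖ ≤ 1 := by
  have h1 : (e a * star (e a)) x = 1 := by
    rw [hstar, ← map_mul, mul_inv_cancel, map_one, Pi.one_apply]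
  have h2 : ‖e a x * star (e a x)‖ = ‖(1 : ℂ)‖ := congrArg norm h1
  rw [norm_mul, norm_star, norm_one] at h2
  nlinarith [norm_nonneg (e a x)]

/-- A finite measure on a standard Borel space is determined by the integrals of a countable group
of measurable unimodular functions that separates points. -/
theorem MeasureTheory.ext_of_forall_integral_eq_of_separating {X G : Type*} [MeasurableSpace X]
    [StandardBorelSpace X] [Group G] [Countable G] {P P' : Measure X} [IsFiniteMeasure P]
    [IsFiniteMeasure P'] (e : G →* (X → ℂ)) (hmeas : ∀ a, Measurable (e a))
    (hstar : ∀ a, star (e a) = e a⁻¹) (hsep : ∀ x y, (∀ a, e a x = e a y) → x = y)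
    (heq : ∀ a, ∫ x, e a x ∂P = ∫ x, e a x ∂P') : P = P' := by
  obtain ⟨t₀, hb₀, hp₀⟩ := StandardBorelSpace.polish (α := X)
  -- Refining the Polish topology makes all the `e a` continuous at once; the finer topology is
  -- still Polish and has the same Borel sets, so the uniqueness theorem for continuous functions
  -- applies.
  obtain ⟨t, ht, hcont, hpol⟩ := (measurable_pi_lambda (fun x a => e a x) hmeas).exists_continuous
  have hborel : @BorelSpace X t _ :=
    @BorelSpace.mk X t _ (hb₀.measurable_eq.trans
      (@borel_eq_borel_of_le X t t₀ hpol hp₀ ht).symm)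
  clear ht hb₀ hp₀
  let b : G → BoundedContinuousFunction X ℂ := fun a =>
    BoundedContinuousFunction.ofNormedAddCommGroup (e a) ((continuous_pi_iff.1 hcont) a) 1 (norm_le_one_of_star_eq_inv e hstar a)
  have hb : ∀ a x, b a x = e a x := fun _ _ => rfl
  let S : Submonoid (BoundedContinuousFunction X ℂ) :=
    { carrier := Set.range b
      one_mem' := ⟨1, by ext x; simp [hb]⟩
      mul_mem' := by
        rintro _ _ ⟨a, rfl⟩ ⟨c, rfl⟩
        exact ⟨a * c, by ext x; simp [hb]⟩ }
  have hS : (S : Set (BoundedContinuousFunction X ℂ)) = Set.range b := rfl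
  have hSstar : star (S : Set (BoundedContinuousFunction X ℂ)) = S := by
    have : ∀ a, star (b a) = b a⁻¹ := by
      intro a
      ext x
      rw [hb, ← hstar]
      rfl
    ext f
    rw [Set.mem_star, hS]
    constructor
    · rintro ⟨a, ha⟩
      exact ⟨a⁻¹, by rw [← this, ha, star_star]⟩
    · rintro ⟨a, rfl⟩
      exact ⟨a⁻¹, (this a).symm⟩
  refine ext_of_forall_mem_subalgebra_integral_eq_of_polish
    (A := StarAlgebra.adjoin ℂ (S : Set (BoundedContinuousFunction X ℂ))) ?_ ?_
  · intro x y hxy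
    by_contra! H
    refine hxy (hsep x y fun a => ?_)
    exact H _ ⟨_, ⟨b a, StarAlgebra.subset_adjoin ℂ _ ⟨a, rfl⟩, rfl⟩, rfl⟩
  · intro g hg
    -- The functions `b a` are closed under products and conjugation, so the star algebra they
    -- generate is just their linear span.
    have hg' : g ∈ Submodule.span ℂ (Set.range b) := by
      rw [← StarSubalgebra.mem_toSubalgebra, StarAlgebra.adjoin_toSubalgebra, hSstar, Set.union_self,
        ← Subalgebra.mem_toSubmodule, Algebra.adjoin_eq_span, Submonoid.closure_eq] at hg
      exact hg
    clear hg
    induction hg' using Submodule.span_induction with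
    | mem g h =>
      obtain ⟨a, rfl⟩ := h
      exact heq a
    | zero => simp
    | add f g _ _ hf hg =>
      simp only [BoundedContinuousFunction.coe_add, Pi.add_apply]
      rw [integral_add (f.integrable P) (g.integrable P),
        integral_add (f.integrable P') (g.integrable P'), hf, hg]
    | smul c g _ hg =>
      simp only [BoundedContinuousFunction.coe_smul, integral_smul, hg]

/-- The finite measures with densities `r⁺` and `r⁻` have the same integral against every `e a`, so
they coincide and `r⁺ = r⁻` almost everywhere. -/
theorem MeasureTheory.ae_eq_zero_of_forall_integral_mul_ofReal_eq_zero {X G : Type*}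
    [MeasurableSpace X] [StandardBorelSpace X] [Group G] [Countable G] {μ : Measure X}
    (e : G →* (X → ℂ)) (hmeas : ∀ a, Measurable (e a)) (hstar : ∀ a, star (e a) = e a⁻¹)
    (hsep : ∀ x y, (∀ a, e a x = e a y) → x = y) {r : X → ℝ} (hr : Integrable r μ)
    (h : ∀ a, ∫ x, e a x * (r x : ℂ) ∂μ = 0) : r =ᵐ[μ] 0 := by
  have := isFiniteMeasure_withDensity_ofReal hr.2
  have := isFiniteMeasure_withDensity_ofReal hr.neg.2
  have hpos : AEMeasurable (fun x => ENNReal.ofReal (r x)) μ := hr.aemeasurable.ennreal_ofReal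
  have hneg : AEMeasurable (fun x => ENNReal.ofReal ((-r) x)) μ :=
    hr.neg.aemeasurable.ennreal_ofReal
  have hbdd : ∀ a, ∀ s : X → ℝ, Integrable s μ → Integrable (fun x => max (s x) 0 • e a x) μ := by
    intro a s hs
    refine hs.pos_part.smul_bdd 1 (hmeas a).aestronglyMeasurable ?_
    filter_upwards with x using norm_le_one_of_star_eq_inv e hstar a x
  have key : (μ.withDensity fun x => ENNReal.ofReal (r x)) =
      μ.withDensity fun x => ENNReal.ofReal ((-r) x) := by
    refine ext_of_forall_integral_eq_of_separating e hmeas hstar hsep fun a => ?_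
    rw [integral_withDensity_eq_integral_toReal_smul₀ hpos (by simp),
      integral_withDensity_eq_integral_toReal_smul₀ hneg (by simp), ← sub_eq_zero]
    simp only [ENNReal.toReal_ofReal']
    rw [← integral_sub (hbdd a r hr) (hbdd a _ hr.neg), ← h a]
    refine integral_congr_ae (.of_forall fun x => ?_)
    simp only [Pi.neg_apply]
    rw [← sub_smul, max_zero_sub_max_neg_zero_eq_self,
      Complex.real_smul, mul_comm]
  rw [withDensity_eq_iff hpos hneg hr.lintegral_lt_top.ne] at key
  filter_upwards [key] with x hx
  have h1 := congrArg ENNReal.toReal hx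
  simp only [ENNReal.toReal_ofReal', Pi.neg_apply] at h1
  rw [Pi.zero_apply, ← max_zero_sub_max_neg_zero_eq_self (r x), h1, sub_self]

/-- An integrable function on a standard Borel space vanishes as soon as it is orthogonal to a
countable group of measurable unimodular functions that separates points. -/
theorem MeasureTheory.ae_eq_zero_of_forall_integral_mul_eq_zero {X G : Type*}
    [MeasurableSpace X] [StandardBorelSpace X] [Group G] [Countable G] {μ : Measure X}
    (e : G →* (X → ℂ)) (hmeas : ∀ a, Measurable (e a)) (hstar : ∀ a, star (e a) = e a⁻¹)
    (hsep : ∀ x y, (∀ a, e a x = e a y) → x = y) {f : X → ℂ} (hf : Integrable f μ)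
    (h : ∀ a, ∫ x, e a x * f x ∂μ = 0) : f =ᵐ[μ] 0 := by
  have hbdd : ∀ a, ∀ u : X → ℂ, Integrable u μ → Integrable (fun x => e a x * u x) μ := by
    intro a u hu
    refine hu.bdd_mul (c := 1) (hmeas a).aestronglyMeasurable ?_
    filter_upwards with x using norm_le_one_of_star_eq_inv e hstar a x
  -- Conjugating the hypothesis at `a⁻¹` transfers it to the conjugate of `f`, hence to its real and
  -- imaginary parts.
  have hconj : ∀ a, ∫ x, e a x * star (f x) ∂μ = 0 := by
    intro a
    have h1 := congrArg (starRingEnd ℂ) (h a⁻¹)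
    rw [← integral_conj, map_zero] at h1
    rw [← h1]
    refine integral_congr_ae (.of_forall fun x => ?_)
    simp only [← hstar, Pi.star_apply, map_mul, RCLike.star_def, Complex.conj_conj]
  have hfc : Integrable (fun x => star (f x)) μ :=
    (Complex.conjLIE.toContinuousLinearEquiv : ℂ →L[ℝ] ℂ).integrable_comp hf
  have hre : (fun x => (f x).re) =ᵐ[μ] 0 := by
    refine ae_eq_zero_of_forall_integral_mul_ofReal_eq_zero e hmeas hstar hsep hf.re fun a => ?_
    have h1 : ∀ x, e a x * ((f x).re : ℂ) = 2⁻¹ * (e a x * f x + e a x * star (f x)) := by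
      intro x
      rw [Complex.re_eq_add_conj, RCLike.star_def]
      ring
    simp only [h1]
    rw [integral_const_mul, integral_add (hbdd a _ hf) (hbdd a _ hfc), h, hconj, add_zero, mul_zero]
  have him : (fun x => (f x).im) =ᵐ[μ] 0 := by
    refine ae_eq_zero_of_forall_integral_mul_ofReal_eq_zero e hmeas hstar hsep hf.im fun a => ?_
    have h1 : ∀ x, e a x * ((f x).im : ℂ) =
        (2 * Complex.I)⁻¹ * (e a x * f x - e a x * star (f x)) := by
      intro x
      rw [Complex.im_eq_sub_conj, RCLike.star_def]
      ring
    simp only [h1]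
    rw [integral_const_mul, integral_sub (hbdd a _ hf) (hbdd a _ hfc), h, hconj, sub_zero, mul_zero]
  filter_upwards [hre, him] with x h1 h2
  exact Complex.ext h1 h2

/-! ### Measurable range functions spanned by sequences. -/

/-- The closed linear span of the values at `x` of a sequence of functions. -/
def closedSpan {X H : Type*} [NormedAddCommGroup H] [InnerProductSpace ℂ H] (f : ℕ → X → H)
    (x : X) : ClosedSubmodule ℂ H :=
  (Submodule.span ℂ (Set.range fun i => f i x)).closure

theorem subset_closedSpan {X H : Type*} [NormedAddCommGroup H] [InnerProductSpace ℂ H]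
    (f : ℕ → X → H) (i : ℕ) (x : X) : f i x ∈ closedSpan f x :=
  subset_closure (Submodule.subset_span ⟨i, rfl⟩)

theorem closedSpan_le {X H : Type*} [NormedAddCommGroup H] [InnerProductSpace ℂ H]
    {f : ℕ → X → H} {x : X} {L : ClosedSubmodule ℂ H} (h : ∀ i, f i x ∈ L) :
    closedSpan f x ≤ L := by
  refine Submodule.topologicalClosure_minimal _ (Submodule.span_le.2 ?_) L.isClosed
  rintro _ ⟨i, rfl⟩
  exact h i

theorem inner_eq_zero_of_mem_closedSpan {X H : Type*} [NormedAddCommGroup H]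
    [InnerProductSpace ℂ H] {f : ℕ → X → H} {x : X} {v w : H} (hv : ∀ i, inner ℂ (f i x) v = 0)
    (hw : w ∈ closedSpan f x) : inner ℂ w v = 0 := by
  have h : closedSpan f x ≤ ⟨(ℂ ∙ v)ᗮ, Submodule.isClosed_orthogonal _⟩ :=
    closedSpan_le fun i => Submodule.mem_orthogonal_singleton_iff_inner_left.2 (hv i)
  exact Submodule.mem_orthogonal_singleton_iff_inner_left.1 (h hw)

/-- Each Gram–Schmidt vector is an explicit expression in inner products and norms of earlier ones.
Where an earlier vector vanishes, the quotient by its squared norm is zero by convention, so no case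
split is needed. -/
theorem stronglyMeasurable_gramSchmidt {X H : Type*} [MeasurableSpace X] [NormedAddCommGroup H]
    [InnerProductSpace ℂ H] {f : ℕ → X → H} (hf : ∀ i, StronglyMeasurable (f i)) (i : ℕ) :
    StronglyMeasurable fun x => InnerProductSpace.gramSchmidt ℂ (fun j => f j x) i := by
  induction i using Nat.strong_induction_on with
  | _ i ih =>
    simp_rw [InnerProductSpace.gramSchmidt_def ℂ _ i, Submodule.starProjection_singleton]
    refine (hf i).sub (Finset.stronglyMeasurable_fun_sum _ fun j hj => ?_)
    have hj' := ih j (Finset.mem_Iio.1 hj)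
    have hdiv := (hj'.inner (𝕜 := ℂ) (hf i)).measurable.div
      (Complex.measurable_ofReal.comp (hj'.norm.pow 2).measurable)
    exact hdiv.stronglyMeasurable.smul hj'

theorem stronglyMeasurable_gramSchmidtNormed {X H : Type*} [MeasurableSpace X]
    [NormedAddCommGroup H] [InnerProductSpace ℂ H] {f : ℕ → X → H}
    (hf : ∀ i, StronglyMeasurable (f i)) (i : ℕ) :
    StronglyMeasurable fun x => InnerProductSpace.gramSchmidtNormed ℂ (fun j => f j x) i := by
  have h := stronglyMeasurable_gramSchmidt hf i
  exact (Complex.continuous_ofReal.comp_stronglyMeasurable h.norm).inv₀.smul h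

theorem starProjection_span_gramSchmidtNormed {H : Type*} [NormedAddCommGroup H]
    [InnerProductSpace ℂ H] (f : ℕ → H) (N : ℕ)
    [(Submodule.span ℂ (f '' Set.Iio N)).HasOrthogonalProjection] (ξ : H) :
    (Submodule.span ℂ (f '' Set.Iio N)).starProjection ξ =
      ∑ i ∈ Finset.range N, inner ℂ (InnerProductSpace.gramSchmidtNormed ℂ f i) ξ •
        InnerProductSpace.gramSchmidtNormed ℂ f i := by
  set e := InnerProductSpace.gramSchmidtNormed ℂ f with he
  have hspan : Submodule.span ℂ (e '' Set.Iio N) = Submodule.span ℂ (f '' Set.Iio N) := by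
    rw [he, InnerProductSpace.span_gramSchmidtNormed, InnerProductSpace.span_gramSchmidt_Iio]
  have horth : ∀ i j, i ≠ j → inner ℂ (e i) (e j) = 0 := by
    intro i j hij
    simp only [he, InnerProductSpace.gramSchmidtNormed, inner_smul_left, inner_smul_right,
      InnerProductSpace.gramSchmidt_orthogonal ℂ f hij, mul_zero]
  refine Submodule.eq_starProjection_of_mem_of_inner_eq_zero ?_ fun w hw => ?_
  · refine Submodule.sum_mem _ fun i hi => Submodule.smul_mem _ _ ?_
    rw [← hspan]
    exact Submodule.subset_span ⟨i, Finset.mem_range.1 hi, rfl⟩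
  · rw [← hspan] at hw
    induction hw using Submodule.span_induction with
    | mem w h =>
      obtain ⟨j, hj, rfl⟩ := h
      rw [inner_sub_left, sum_inner, Finset.sum_eq_single j]
      · rw [inner_smul_left, inner_conj_symm]
        -- Linearly dependent inputs produce zero vectors, which contribute nothing to the sum; the
        -- others have norm one.
        by_cases h0 : e j = 0
        · simp [h0]
        · rw [inner_self_eq_norm_sq_to_K, InnerProductSpace.gramSchmidtNormed_unit_length' h0]
          simp
      · intro i _ hij
        rw [inner_smul_left, horth i j hij, mul_zero]
      · intro h
        exact absurd (Finset.mem_range.2 hj) h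
    | zero => exact inner_zero_right _
    | add u v _ _ hu hv => rw [inner_add_right, hu, hv, add_zero]
    | smul c u _ hu => rw [inner_smul_right, hu, mul_zero]

/-- The projection onto the closed span is the pointwise strong limit of the projections onto the
spans of the first `N` vectors, and these are finite Gram–Schmidt sums. -/
theorem isMeasurableRangeFunction_closedSpan {X H : Type*} [MeasurableSpace X]
    [NormedAddCommGroup H] [InnerProductSpace ℂ H] [CompleteSpace H] {f : ℕ → X → H}
    (hf : ∀ i, StronglyMeasurable (f i)) :
    CrystalGroup.IsMeasurableRangeFunction (closedSpan f) := by
  intro ξ η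
  let U : X → ℕ → Submodule ℂ H := fun x N => Submodule.span ℂ ((fun i => f i x) '' Set.Iio N)
  have hfin : ∀ x N, FiniteDimensional ℂ (U x N) := fun x N =>
    FiniteDimensional.span_of_finite ℂ ((Set.finite_Iio N).image _)
  have hmono : ∀ x, Monotone (U x) := fun x N N' h =>
    Submodule.span_mono (Set.image_mono (Set.Iio_subset_Iio h))
  have hsup : ∀ x, (closedSpan f x).toSubmodule = (⨆ N, U x N).topologicalClosure := by
    intro x
    have h : (⨆ N, U x N) = Submodule.span ℂ (Set.range fun i => f i x) := by
      rw [← Submodule.span_iUnion, ← Set.image_iUnion, Set.iUnion_Iio, Set.image_univ]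
    rw [h]
    rfl
  have hlim : ∀ x, Filter.Tendsto (fun N => (U x N).starProjection ξ) Filter.atTop
      (nhds ((closedSpan f x).toSubmodule.starProjection ξ)) := by
    intro x
    simp only [hsup x]
    exact Submodule.starProjection_tendsto_closure_iSup (U x) (hmono x) ξ
  have hmeas : StronglyMeasurable fun x => (closedSpan f x).toSubmodule.starProjection ξ := by
    refine stronglyMeasurable_of_tendsto Filter.atTop (fun N => ?_) (tendsto_pi_nhds.2 hlim)
    simp only [U, starProjection_span_gramSchmidtNormed]
    exact Finset.stronglyMeasurable_fun_sum _ fun i _ =>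
      ((stronglyMeasurable_gramSchmidtNormed hf i).inner stronglyMeasurable_const).smul
        (stronglyMeasurable_gramSchmidtNormed hf i)
  exact (hmeas.inner stronglyMeasurable_const).measurable

/-- A closed subspace of `L²(X, H)` whose members are pointwise orthogonal to the members of its
orthogonal complement is the space of sections of a measurable range function, spanned pointwise by
countably many members of the subspace. -/
theorem exists_closedSpan_eq_rangeSpace {X H : Type*} [MeasurableSpace X]
    [NormedAddCommGroup H] [InnerProductSpace ℂ H] [CompleteSpace H] {μ : Measure X}
    [SecondCountableTopology (Lp H 2 μ)] (K : Submodule ℂ (Lp H 2 μ))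
    (hK : IsClosed (K : Set (Lp H 2 μ)))
    (horth : ∀ F ∈ K, ∀ G ∈ Kᗮ, ∀ᵐ x ∂μ, inner ℂ (F x) (G x) = 0) :
    ∃ F : ℕ → Lp H 2 μ, (∀ i, F i ∈ K) ∧
      K = CrystalGroup.rangeSpace μ (closedSpan fun i => F i) := by
  let F : ℕ → Lp H 2 μ := fun i => (TopologicalSpace.denseSeq K i : K)
  have hF : ∀ i, F i ∈ K := fun i => (TopologicalSpace.denseSeq K i).2
  have hle : K ≤ CrystalGroup.rangeSpace μ (closedSpan fun i => F i) := by
    intro G hG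
    obtain ⟨u, hu⟩ : ∃ u : ℕ → ℕ, Filter.Tendsto (fun k => F (u k)) Filter.atTop (nhds G) := by
      have h1 : (⟨G, hG⟩ : K) ∈ closure (Set.range (TopologicalSpace.denseSeq K)) :=
        TopologicalSpace.denseRange_denseSeq K _
      obtain ⟨v, hv, hlim⟩ := mem_closure_iff_seq_limit.1 h1
      choose u hu using hv
      refine ⟨u, ?_⟩
      have h2 := (continuous_subtype_val.tendsto _).comp hlim
      refine h2.congr fun k => ?_
      simp [F, hu]
    -- Convergence in `L²` gives almost everywhere convergence along a subsequence, and the fibres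
    -- are closed.
    obtain ⟨φ, -, hφ⟩ := (tendstoInMeasure_of_tendsto_Lp hu).exists_seq_tendsto_ae
    filter_upwards [hφ] with x hx
    exact (closedSpan (fun i => F i) x).isClosed.mem_of_tendsto hx
      (.of_forall fun k => subset_closedSpan (fun i => F i) _ x)
  refine ⟨F, hF, le_antisymm hle fun G hG => ?_⟩
  have : CompleteSpace K := hK.completeSpace_coe
  have hPK : K.starProjection G ∈ K := Submodule.starProjection_apply_mem K G
  have hD : G - K.starProjection G ∈ Kᗮ := Submodule.sub_starProjection_mem_orthogonal G
  have hDJ := (CrystalGroup.rangeSpace μ (closedSpan fun i => F i)).sub_mem hG (hle hPK)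
  have hzero : G - K.starProjection G = 0 := by
    refine Lp.ext ?_
    have h1 : ∀ᵐ x ∂μ, ∀ i, inner ℂ (F i x) ((G - K.starProjection G : Lp H 2 μ) x) = 0 :=
      ae_all_iff.2 fun i => horth _ (hF i) _ hD
    have h2 : ∀ᵐ x ∂μ, (G - K.starProjection G : Lp H 2 μ) x ∈ closedSpan (fun i => F i) x := hDJ
    filter_upwards [h1, h2, Lp.coeFn_zero H 2 μ] with x hx1 hx2 hx3
    rw [hx3, Pi.zero_apply, ← inner_self_eq_zero (𝕜 := ℂ)]
    exact inner_eq_zero_of_mem_closedSpan hx1 hx2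
  rw [sub_eq_zero.1 hzero]
  exact hPK

/-! ### Lattices, countability and the geometry of `ΠΩ`. -/

namespace CrystalGroup

/-- A discrete subspace of a second countable space is countable. -/
theorem countable_of_isCrystalGroup {n : ℕ} {Γ : Subgroup (EucIso n)} (hΓ : IsCrystalGroup Γ) :
    Countable Γ := by
  let _ := isoTopology n
  have := hΓ.discrete
  have : SecondCountableTopology (EucIso n) := TopologicalSpace.secondCountableTopology_induced _ _ _
  exact TopologicalSpace.separableSpace_iff_countable.1 inferInstance

theorem surjective_toPointGroup {n : ℕ} (Γ : Subgroup (EucIso n)) :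
    Function.Surjective (toPointGroup Γ) := by
  rintro ⟨M, g, hg, rfl⟩
  exact ⟨⟨g, hg⟩, rfl⟩

/-- The translation by a vector of the translation lattice, as an element of `Γ`. -/
noncomputable def translation {n : ℕ} {Γ : Subgroup (EucIso n)} (ℓ : translationLattice Γ) : Γ :=
  ⟨AffineIsometryEquiv.constVAdd ℝ (E n) ℓ, ℓ.2⟩

theorem transPart_translation {n : ℕ} {Γ : Subgroup (EucIso n)} (ℓ : translationLattice Γ) :
    transPart (translation ℓ : EucIso n) = ℓ := by
  change (ℓ : E n) +ᵥ (0 : E n) = ℓ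
  simp

theorem toPointGroup_translation {n : ℕ} {Γ : Subgroup (EucIso n)} (ℓ : translationLattice Γ) :
    toPointGroup Γ (translation ℓ) = 1 := by
  apply Subtype.ext
  change linPart (AffineIsometryEquiv.constVAdd ℝ (E n) (ℓ : E n)) = 1
  ext1 z
  rfl

theorem countable_translationLattice {n : ℕ} {Γ : Subgroup (EucIso n)} [Countable Γ] :
    Countable (translationLattice Γ) := by
  refine Function.Injective.countable (f := translation) fun a b h => Subtype.ext ?_
  rw [← transPart_translation a, h, transPart_translation]

/-- Conjugating a translation by an element of `Γ` with linear part `M` gives the translation by `M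
ℓ`. -/
theorem map_mem_translationLattice {n : ℕ} {Γ : Subgroup (EucIso n)} {M : E n ≃ₗᵢ[ℝ] E n}
    (hM : M ∈ pointGroup Γ) {ℓ : E n} (hℓ : ℓ ∈ translationLattice Γ) :
    M ℓ ∈ translationLattice Γ := by
  obtain ⟨g, hg, rfl⟩ := hM
  have h : AffineIsometryEquiv.constVAdd ℝ (E n) (linPart g ℓ) =
      g * AffineIsometryEquiv.constVAdd ℝ (E n) ℓ * g⁻¹ := by
    ext1 z
    change linPart g ℓ + z = g (ℓ + g⁻¹ z)
    have h1 : g (g⁻¹ z) = z := g.apply_symm_apply z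
    rw [eucIso_apply, add_assoc, map_add, ← eucIso_apply, h1]
  change AffineIsometryEquiv.constVAdd ℝ (E n) (linPart g ℓ) ∈ Γ
  rw [h]
  exact Γ.mul_mem (Γ.mul_mem hg hℓ) (Γ.inv_mem hg)

theorem map_mem_dualLattice {n : ℕ} {Γ : Subgroup (EucIso n)} {M : E n ≃ₗᵢ[ℝ] E n}
    (hM : M ∈ pointGroup Γ) {ν : E n} (hν : ν ∈ dualLattice Γ) : M ν ∈ dualLattice Γ := by
  intro ℓ hℓ
  obtain ⟨m, hm⟩ := hν _ (map_mem_translationLattice ((pointGroup Γ).inv_mem hM) hℓ)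
  refine ⟨m, ?_⟩
  rw [← hm, ← LinearIsometryEquiv.inner_map_map M ν (M⁻¹ ℓ)]
  congr 1
  exact (M.apply_symm_apply ℓ).symm

/-- A point and its image under a nontrivial element of `Γ*` do not both lie in the Dirichlet
domain. -/
theorem eq_one_of_mem_dirichletDomain {n : ℕ} {Γ : Subgroup (EucIso n)} {ω₀ ω ν : E n}
    {M : E n ≃ₗᵢ[ℝ] E n} (hν : ν ∈ dualLattice Γ) (hM : M ∈ pointGroup Γ)
    (hω : ω ∈ dirichletDomain Γ ω₀) (hω' : M (ω + ν) ∈ dirichletDomain Γ ω₀) :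
    ν = 0 ∧ M = 1 := by
  by_contra hne
  have h1 := hω' ν hν M hM hne
  -- `(-M ν, M⁻¹)` is the inverse of `(ν, M)` in `Γ*`. The two Dirichlet inequalities then compare
  -- the same two distances in opposite directions.
  have h2 := hω (-M ν) (neg_mem (map_mem_dualLattice hM hν)) M⁻¹ ((pointGroup Γ).inv_mem hM) (by
    rintro ⟨h3, h4⟩
    refine hne ⟨?_, inv_eq_one.1 h4⟩
    rw [neg_eq_zero] at h3
    exact M.map_eq_zero_iff.1 h3)
  have h5 : ‖M (ω + ν) - M (ω₀ + ν)‖ = ‖ω - ω₀‖ := by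
    rw [← map_sub, M.norm_map, add_sub_add_right_eq_sub]
  have h6 : ‖ω - M⁻¹ (ω₀ + -M ν)‖ = ‖M (ω + ν) - ω₀‖ := by
    rw [← M.norm_map, map_sub]
    have h7 : M (M⁻¹ (ω₀ + -M ν)) = ω₀ + -M ν := M.apply_symm_apply _
    rw [h7, map_add]
    congr 1
    abel
  rw [h5] at h1
  rw [h6] at h2
  exact lt_asymm h1 h2

/-- Distinct points of `ΠΩ` are not congruent modulo the dual lattice. -/
theorem eq_of_sub_mem_dualLattice {n : ℕ} {Γ : Subgroup (EucIso n)} {ω₀ θ θ' : E n}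
    (hθ : θ ∈ pointOrbit Γ ω₀) (hθ' : θ' ∈ pointOrbit Γ ω₀) (h : θ - θ' ∈ dualLattice Γ) :
    θ = θ' := by
  simp only [pointOrbit, Set.mem_iUnion, Set.mem_image, exists_prop] at hθ hθ'
  obtain ⟨M, hM, ω, hω, rfl⟩ := hθ
  obtain ⟨M', hM', ω', hω', rfl⟩ := hθ'
  have hν := map_mem_dualLattice ((pointGroup Γ).inv_mem hM') h
  -- An element of `Γ*` takes `ω'` to `ω`, both in the Dirichlet domain, so its translation part
  -- must vanish.
  have hω2 : (M⁻¹ * M') (ω' + M'⁻¹ (M ω - M' ω')) = ω := by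
    change M.symm (M' (ω' + M'.symm (M ω - M' ω'))) = ω
    simp
  have h1 := (eq_one_of_mem_dirichletDomain hν ((pointGroup Γ).mul_mem ((pointGroup Γ).inv_mem hM) hM')
    hω' (by rwa [hω2])).1
  exact sub_eq_zero.1 ((M'⁻¹).map_eq_zero_iff.1 h1)

theorem measurableSet_pointOrbit {n : ℕ} {Γ : Subgroup (EucIso n)} [Countable (pointGroup Γ)]
    [Countable (dualLattice Γ)] (ω₀ : E n) : MeasurableSet (pointOrbit Γ ω₀) := by
  have hΩ : MeasurableSet (dirichletDomain Γ ω₀) := by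
    have h : dirichletDomain Γ ω₀ = ⋂ (ν : dualLattice Γ) (M : pointGroup Γ)
        (_ : ¬ ((ν : E n) = 0 ∧ (M : E n ≃ₗᵢ[ℝ] E n) = 1)),
        {ω | ‖ω - ω₀‖ < ‖ω - (M : E n ≃ₗᵢ[ℝ] E n) (ω₀ + ν)‖} := by
      ext ω
      simp only [dirichletDomain, Set.mem_ofPred_eq, Set.mem_iInter, Subtype.forall]
    rw [h]
    refine .iInter fun ν => .iInter fun M => .iInter fun _ => ?_
    exact measurableSet_lt (by fun_prop) (by fun_prop)
  refine .biUnion (Set.to_countable (pointGroup Γ : Set (E n ≃ₗᵢ[ℝ] E n))) fun M _ => ?_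
  exact M.toHomeomorph.measurableEmbedding.measurableSet_image.2 hΩ

/-- A dual vector is determined by its integer pairings with a finite spanning family chosen inside
`𝓛`. -/
theorem countable_dual_of_span_eq_top {n : ℕ} {𝓛 : AddSubgroup (E n)}
    (h : Submodule.span ℝ (𝓛 : Set (E n)) = ⊤) : Countable (dual 𝓛) := by
  obtain ⟨b, hb, hspan, -⟩ := Submodule.exists_fun_fin_finrank_span_eq ℝ (𝓛 : Set (E n))
  have hint : ∀ (ν : dual 𝓛) i, ∃ m : ℤ, inner ℝ (ν : E n) (b i) = (m : ℝ) := fun ν i =>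
    ν.2 _ (hb i)
  choose c hc using hint
  refine Function.Injective.countable (f := c) fun ν ν' hν => Subtype.ext ?_
  replace hspan := hspan.trans h
  have h1 : ∀ w ∈ Submodule.span ℝ (Set.range b), inner ℝ ((ν : E n) - ν') w = 0 := by
    intro w hw
    induction hw using Submodule.span_induction with
    | mem w hw =>
      obtain ⟨i, rfl⟩ := hw
      rw [inner_sub_left, hc, hc, hν, sub_self]
    | zero => exact inner_zero_right _
    | add u v _ _ hu hv => rw [inner_add_right, hu, hv, add_zero]
    | smul r u _ hu => rw [inner_smul_right, hu, mul_zero]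
  exact sub_eq_zero.1 (inner_self_eq_zero.1 (h1 _ (hspan ▸ Submodule.mem_top)))

/-- If the translation lattice does not span `ℝⁿ` then the Dirichlet domain lies in a hyperplane. -/
theorem volume_pointOrbit_of_span_ne_top {n : ℕ} {Γ : Subgroup (EucIso n)}
    [Countable (pointGroup Γ)] (ω₀ : E n)
    (h : Submodule.span ℝ (translationLattice Γ : Set (E n)) ≠ ⊤) :
    volume (pointOrbit Γ ω₀) = 0 := by
  have hperp : (Submodule.span ℝ (translationLattice Γ : Set (E n)))ᗮ ≠ ⊥ := fun h' =>
    h (Submodule.orthogonal_eq_bot_iff.1 h')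
  obtain ⟨v, hv, hv0⟩ := Submodule.exists_mem_ne_zero_of_ne_bot hperp
  have hvL : ∀ ℓ ∈ translationLattice Γ, inner ℝ v ℓ = 0 := fun ℓ hℓ =>
    Submodule.inner_left_of_mem_orthogonal (Submodule.subset_span hℓ) hv
  have hdual : ∀ t : ℝ, t • v ∈ dualLattice Γ := fun t ℓ hℓ =>
    ⟨0, by rw [inner_smul_left, hvL ℓ hℓ, mul_zero, Int.cast_zero]⟩
  have hsub : dirichletDomain Γ ω₀ ⊆ AffineSubspace.mk' ω₀ (ℝ ∙ v)ᗮ := by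
    intro ω hω
    rw [SetLike.mem_coe, AffineSubspace.mem_mk', vsub_eq_sub,
      Submodule.mem_orthogonal_singleton_iff_inner_left]
    by_contra hne
    set a := inner ℝ (ω - ω₀) v with ha
    have hv2 : 0 < ‖v‖ ^ 2 := by positivity
    -- Every real multiple of `v` is in the dual lattice. The one used here is the projection of `ω
    -- - ω₀` to the line of `v`; moving `ω₀` by it cannot increase the distance to `ω`.
    have h1 := hω ((a / ‖v‖ ^ 2) • v) (hdual _) 1 (pointGroup Γ).one_mem (by
      rintro ⟨h2, -⟩
      exact smul_ne_zero (div_ne_zero hne hv2.ne') hv0 h2)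
    have h2 : ω - (1 : E n ≃ₗᵢ[ℝ] E n) (ω₀ + (a / ‖v‖ ^ 2) • v) =
        (ω - ω₀) - (a / ‖v‖ ^ 2) • v := by
      change ω - (ω₀ + (a / ‖v‖ ^ 2) • v) = _
      abel
    rw [h2] at h1
    have h3 := pow_lt_pow_left₀ h1 (norm_nonneg _) two_ne_zero
    rw [norm_sub_sq_real (ω - ω₀), inner_smul_right, ← ha, norm_smul, mul_pow, Real.norm_eq_abs,
      sq_abs] at h3
    have h4 : (a / ‖v‖ ^ 2) ^ 2 * ‖v‖ ^ 2 = a / ‖v‖ ^ 2 * a := by field_simp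
    have h5 : 0 ≤ a / ‖v‖ ^ 2 * a := by
      rw [← h4]
      positivity
    linarith
  have hne : AffineSubspace.mk' ω₀ (ℝ ∙ v)ᗮ ≠ ⊤ := by
    intro h'
    have h1 := congrArg AffineSubspace.direction h'
    rw [AffineSubspace.direction_mk', AffineSubspace.direction_top] at h1
    have h2 : v ∈ (ℝ ∙ v)ᗮ := h1 ▸ Submodule.mem_top
    exact hv0 (inner_self_eq_zero.1 (Submodule.mem_orthogonal_singleton_iff_inner_left.1 h2))
  have hΩ : volume (dirichletDomain Γ ω₀) = 0 :=
    measure_mono_null hsub (Measure.addHaar_affineSubspace volume _ hne)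
  refine (measure_biUnion_null_iff
    (Set.to_countable (pointGroup Γ : Set (E n ≃ₗᵢ[ℝ] E n)))).2 fun M _ => ?_
  have h1 := M.symm.measurePreserving.measure_preimage_emb
    M.symm.toHomeomorph.measurableEmbedding (dirichletDomain Γ ω₀)
  rw [hΩ] at h1
  rw [← h1]
  congr 1
  exact M.toEquiv.image_eq_preimage_symm _

/-- Images of subsets of `ΠΩ` are null, hence null measurable, so the comap formula applies without
measurability of `ΠΩ` itself. -/
theorem orbitMeasure_eq_zero {n : ℕ} {Γ : Subgroup (EucIso n)} {ω₀ : E n}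
    (h : volume (pointOrbit Γ ω₀) = 0) : orbitMeasure Γ ω₀ = 0 := by
  have hnull : ∀ s : Set (pointOrbit Γ ω₀), volume (Subtype.val '' s : Set (E n)) = 0 := fun s =>
    measure_mono_null (Subtype.coe_image_subset _ s) h
  ext s hs
  rw [orbitMeasure, Measure.comap_apply₀ _ _ Subtype.val_injective
    (fun s _ => .of_null (hnull s)) hs.nullMeasurableSet, hnull]
  rfl

theorem sigmaFinite_orbitMeasure {n : ℕ} {Γ : Subgroup (EucIso n)} {ω₀ : E n}
    (h : MeasurableSet (pointOrbit Γ ω₀)) : SigmaFinite (orbitMeasure Γ ω₀) := by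
  refine SigmaFinite.of_map _ measurable_subtype_coe.aemeasurable ?_
  rw [orbitMeasure, (MeasurableEmbedding.subtype_coe h).map_comap]
  infer_instance

end CrystalGroup

theorem lp.separableSpace_two {ι : Type*} [Countable ι] :
    TopologicalSpace.SeparableSpace (lp (fun _ : ι => ℂ) 2) := by
  let b : HilbertBasis ι ℂ (lp (fun _ : ι => ℂ) 2) := ⟨LinearIsometryEquiv.refl ℂ _⟩
  have h := ((Set.countable_range b).isSeparable.span (R := ℂ)).closure
  rw [← Submodule.topologicalClosure_coe, b.dense_span] at h
  exact TopologicalSpace.isSeparable_univ_iff.1 h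

/-! ### Lattice characters and invariance. -/

namespace CrystalGroup

/-- The character `θ ↦ e^{2πi θ·ℓ}` on `ΠΩ`, for `ℓ` in the translation lattice. -/
noncomputable def latticeCharacter {n : ℕ} (Γ : Subgroup (EucIso n)) (ω₀ : E n) :
    Multiplicative (translationLattice Γ) →* (pointOrbit Γ ω₀ → ℂ) where
  toFun ℓ θ := Complex.exp (2 * Real.pi * Complex.I *
    (inner ℝ (θ : E n) (ℓ.toAdd : E n) : ℝ))
  map_one' := by
    ext θ
    simp
  map_mul' a b := by
    ext θ
    simp only [toAdd_mul, AddSubgroup.coe_add, inner_add_right, Pi.mul_apply, ← Complex.exp_add]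
    push_cast
    ring_nf

theorem latticeCharacter_apply {n : ℕ} {Γ : Subgroup (EucIso n)} {ω₀ : E n}
    (ℓ : Multiplicative (translationLattice Γ)) (θ : pointOrbit Γ ω₀) :
    latticeCharacter Γ ω₀ ℓ θ = Complex.exp (2 * Real.pi * Complex.I *
      (inner ℝ (θ : E n) (ℓ.toAdd : E n) : ℝ)) := rfl

theorem measurable_latticeCharacter {n : ℕ} {Γ : Subgroup (EucIso n)} {ω₀ : E n}
    (ℓ : Multiplicative (translationLattice Γ)) : Measurable (latticeCharacter Γ ω₀ ℓ) := by
  have h : Measurable fun θ : pointOrbit Γ ω₀ => (inner ℝ (θ : E n) (ℓ.toAdd : E n) : ℝ) :=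
    measurable_subtype_coe.inner_const
  change Measurable fun θ : pointOrbit Γ ω₀ => Complex.exp (2 * Real.pi * Complex.I *
    (inner ℝ (θ : E n) (ℓ.toAdd : E n) : ℝ))
  fun_prop

theorem star_latticeCharacter {n : ℕ} {Γ : Subgroup (EucIso n)} {ω₀ : E n}
    (ℓ : Multiplicative (translationLattice Γ)) :
    star (latticeCharacter Γ ω₀ ℓ) = latticeCharacter Γ ω₀ ℓ⁻¹ := by
  ext θ
  simp only [Pi.star_apply, latticeCharacter_apply, RCLike.star_def, ← Complex.exp_conj]
  simp [map_ofNat]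

/-- The characters of the translation lattice separate the points of `ΠΩ`. -/
theorem eq_of_latticeCharacter_eq {n : ℕ} {Γ : Subgroup (EucIso n)} {ω₀ : E n}
    {θ θ' : pointOrbit Γ ω₀}
    (h : ∀ ℓ, latticeCharacter Γ ω₀ ℓ θ = latticeCharacter Γ ω₀ ℓ θ') : θ = θ' := by
  refine Subtype.ext (eq_of_sub_mem_dualLattice θ.2 θ'.2 fun ℓ hℓ => ?_)
  obtain ⟨m, hm⟩ := Complex.exp_eq_exp_iff_exists_int.1 (h (Multiplicative.ofAdd ⟨ℓ, hℓ⟩))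
  refine ⟨m, ?_⟩
  have h2 : (2 * Real.pi * Complex.I : ℂ) ≠ 0 := Complex.two_pi_I_ne_zero
  simp only [toAdd_ofAdd] at hm
  rw [inner_sub_left, sub_eq_iff_eq_add']
  have h3 : ((inner ℝ (θ : E n) ℓ : ℝ) : ℂ) = (inner ℝ (θ' : E n) ℓ : ℝ) + m :=
    mul_left_cancel₀ h2 (by rw [hm]; ring)
  exact_mod_cast h3

theorem piThree_translation_ae {n : ℕ} {Γ : Subgroup (EucIso n)} {ω₀ : E n}
    (ℓ : Multiplicative (translationLattice Γ)) (F : LTwo Γ ω₀) :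
    ∀ᵐ θ ∂(orbitMeasure Γ ω₀),
      piThree Γ ω₀ (translation ℓ.toAdd) F θ = latticeCharacter Γ ω₀ ℓ θ • F θ := by
  filter_upwards [piThree_ae (translation ℓ.toAdd) F] with θ hθ
  rw [hθ, toPointGroup_translation, inv_one, one_smul, transPart_translation,
    latticeCharacter_apply]

/-- Orthogonality of `G` to all lattice translates of `F` says that every Fourier coefficient of the
pointwise inner product vanishes. -/
theorem inner_ae_eq_zero_of_isInvariant {n : ℕ} {Γ : Subgroup (EucIso n)} {ω₀ : E n}
    [Countable (translationLattice Γ)] (hmeas : MeasurableSet (pointOrbit Γ ω₀))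
    {K : Submodule ℂ (LTwo Γ ω₀)} (hinv : IsInvariant (piThree Γ ω₀) K) {F G : LTwo Γ ω₀}
    (hF : F ∈ K) (hG : G ∈ Kᗮ) :
    ∀ᵐ θ ∂(orbitMeasure Γ ω₀), inner ℂ (F θ) (G θ) = 0 := by
  have := hmeas.standardBorel
  have : Countable (Multiplicative (translationLattice Γ)) := ‹Countable (translationLattice Γ)›
  have h := ae_eq_zero_of_forall_integral_mul_eq_zero (latticeCharacter Γ ω₀)
    measurable_latticeCharacter star_latticeCharacter (fun _ _ => eq_of_latticeCharacter_eq)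
    -- `F` sits in the linear slot, so the character comes out unconjugated.
    (L2.integrable_inner (𝕜 := ℂ) G F) fun ℓ => by
      have h1 := Submodule.inner_left_of_mem_orthogonal (hinv (translation ℓ.toAdd) F hF) hG
      rw [L2.inner_def] at h1
      rw [← h1]
      refine integral_congr_ae ?_
      filter_upwards [piThree_translation_ae ℓ F] with θ hθ
      rw [hθ, inner_smul_right]
  filter_upwards [h] with θ hθ
  exact inner_eq_zero_symm.1 hθ

/-- The space of sections of a `Π`-invariant range function is invariant. -/
theorem isInvariant_rangeSpace {n : ℕ} {Γ : Subgroup (EucIso n)} {ω₀ : E n}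
    {J : pointOrbit Γ ω₀ → ClosedSubmodule ℂ (EllTwo Γ)} (hJ : IsPointInvariant J) :
    IsInvariant (piThree Γ ω₀) (rangeSpace (orbitMeasure Γ ω₀) J) := by
  intro g F hF
  have hF' : ∀ᵐ θ ∂(orbitMeasure Γ ω₀), F θ ∈ J θ := hF
  filter_upwards [piThree_ae g F, hJ, (measurePreserving_smul_pointOrbit (ω₀ := ω₀)
    (toPointGroup Γ g)⁻¹).quasiMeasurePreserving.ae hF'] with θ h1 h2 h3
  rw [h1]
  rw [h2] at h3
  exact (J θ).smul_mem _ h3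

theorem mem_of_piThree_mem_rangeSpace {n : ℕ} {Γ : Subgroup (EucIso n)} {ω₀ : E n}
    {J : pointOrbit Γ ω₀ → ClosedSubmodule ℂ (EllTwo Γ)} {g : Γ} {F : LTwo Γ ω₀}
    (h : piThree Γ ω₀ g F ∈ rangeSpace (orbitMeasure Γ ω₀) J) :
    ∀ᵐ θ ∂(orbitMeasure Γ ω₀), F ((toPointGroup Γ g)⁻¹ • θ) ∈ J θ := by
  have h' : ∀ᵐ θ ∂(orbitMeasure Γ ω₀), piThree Γ ω₀ g F θ ∈ J θ := h
  filter_upwards [h', piThree_ae g F] with θ h1 h2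
  rw [h2] at h1
  exact ((J θ).toSubmodule.smul_mem_iff (Complex.exp_ne_zero _)).1 h1

/-- A range function spanned pointwise by members of an invariant space of sections is
`Π`-invariant. -/
theorem isPointInvariant_closedSpan {n : ℕ} {Γ : Subgroup (EucIso n)} {ω₀ : E n}
    [Countable (pointGroup Γ)] {F : ℕ → LTwo Γ ω₀}
    (h : ∀ g i, piThree Γ ω₀ g (F i) ∈ rangeSpace (orbitMeasure Γ ω₀) (closedSpan fun i => F i)) :
    IsPointInvariant (closedSpan fun i => F i) := by
  have hle : ∀ M : pointGroup Γ, ∀ᵐ θ ∂(orbitMeasure Γ ω₀),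
      closedSpan (fun i => F i) (M • θ) ≤ closedSpan (fun i => F i) θ := by
    intro M
    -- `piThree` evaluates at the inverse of the point part, so an element over `M⁻¹` brings in the
    -- values at `M • θ`.
    obtain ⟨g, hg⟩ := surjective_toPointGroup Γ M⁻¹
    filter_upwards [ae_all_iff.2 fun i => mem_of_piThree_mem_rangeSpace (h g i)] with θ hθ
    rw [hg, inv_inv] at hθ
    exact closedSpan_le hθ
  refine ae_all_iff.2 fun M => ?_
  -- The reverse inclusion is the one for `M⁻¹` taken at `M • θ`.
  filter_upwards [hle M, (measurePreserving_smul_pointOrbit (ω₀ := ω₀)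
    M).quasiMeasurePreserving.ae (hle M⁻¹)] with θ h1 h2
  rw [inv_smul_smul] at h2
  exact le_antisymm h1 h2

end CrystalGroup

theorem proposition6p2 {n : ℕ} (hn : 0 < n)
    (Γ : Subgroup (CrystalGroup.EucIso n)) (hΓ : CrystalGroup.IsCrystalGroup Γ)
    (ω₀ : CrystalGroup.E n) (hω₀ : CrystalGroup.TrivialStabilizer Γ ω₀)
    (K : Submodule ℂ (CrystalGroup.LTwo Γ ω₀)) (hK : IsClosed (K : Set (CrystalGroup.LTwo Γ ω₀))) :
    CrystalGroup.IsInvariant (CrystalGroup.piThree Γ ω₀) K ↔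
      ∃ J : CrystalGroup.pointOrbit Γ ω₀ → ClosedSubmodule ℂ (CrystalGroup.EllTwo Γ),
        CrystalGroup.IsMeasurableRangeFunction J ∧ CrystalGroup.IsPointInvariant J ∧
          K = CrystalGroup.rangeSpace (CrystalGroup.orbitMeasure Γ ω₀) J := by
  have := CrystalGroup.countable_of_isCrystalGroup hΓ
  have : Countable (CrystalGroup.pointGroup Γ) := (CrystalGroup.surjective_toPointGroup Γ).countable
  have : Countable (CrystalGroup.translationLattice Γ) := CrystalGroup.countable_translationLattice
  refine ⟨fun hinv => ?_, ?_⟩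
  · by_cases hspan : Submodule.span ℝ (CrystalGroup.translationLattice Γ : Set (CrystalGroup.E n)) = ⊤
    · have : Countable (CrystalGroup.dualLattice Γ) :=
        CrystalGroup.countable_dual_of_span_eq_top hspan
      have hmeas := CrystalGroup.measurableSet_pointOrbit (Γ := Γ) ω₀
      -- σ-finiteness of the measure and separability of `ℓ²(𝓛*)` make `L²` second countable, which
      -- provides the dense sequence in `K`.
      have := CrystalGroup.sigmaFinite_orbitMeasure hmeas
      have : TopologicalSpace.SeparableSpace (CrystalGroup.EllTwo Γ) := lp.separableSpace_two
      have : Fact ((2 : ENNReal) ≠ ⊤) := ⟨ENNReal.ofNat_ne_top⟩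
      obtain ⟨F, hF, hKF⟩ := exists_closedSpan_eq_rangeSpace K hK fun F hF G hG =>
        CrystalGroup.inner_ae_eq_zero_of_isInvariant hmeas hinv hF hG
      refine ⟨closedSpan fun i => F i, isMeasurableRangeFunction_closedSpan fun i =>
        Lp.stronglyMeasurable (F i), CrystalGroup.isPointInvariant_closedSpan fun g i => ?_, hKF⟩
      rw [← hKF]
      exact hinv g _ (hF i)
    -- The measure is zero here, so `L²` is trivial and the zero range function serves.
    · have hμ := CrystalGroup.orbitMeasure_eq_zero
        (CrystalGroup.volume_pointOrbit_of_span_ne_top ω₀ hspan)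
      have hae : ∀ p : CrystalGroup.pointOrbit Γ ω₀ → Prop,
          ∀ᵐ θ ∂(CrystalGroup.orbitMeasure Γ ω₀), p θ := by
        intro p
        rw [hμ]
        exact ae_zero.le Filter.mem_bot
      refine ⟨fun _ => ⊥, fun ξ η => measurable_const
        (a := inner ℂ ((⊥ : ClosedSubmodule ℂ _).toSubmodule.starProjection ξ) η), .of_forall fun θ L => rfl, ?_⟩
      ext F
      have hF : F = 0 := Lp.ext (hae _)
      exact iff_of_true (hF ▸ K.zero_mem) (hae _)
  · rintro ⟨J, -, hJ, rfl⟩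
    exact CrystalGroup.isInvariant_rangeSpace hJ
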